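/- **Proposition 3.5 (Poincaré inequality on the $\mathbb R$-tree).** Let $\mathbf b:\mathbb Z\to\mathbb N$ satisfy $2\le\inf_{\mathbb Z}\mathbf b\le\sup_{\mathbb Z}\mathbf b<+\infty$ and let $p\in(1,+\infty)$. *Volume function and ultrametric measure.* For $r>0$ let $n\in\mathbb Z$ be such that $2^{n-1}\le r<2^n$, and put $V_{\mathbf b}(r)=\big(\prod_{k=n}^{0}\mathbf b(k)\big)^{-1}$ if $n\le0$ and $V_{\mathbf b}(r)=\prod_{k=1}^{n-1}\mathbf b(k)$ if $n\ge1$. Let $\mathcal U(\mathbf b)$ be the set of all $\mathbf s:\mathbb Z\to\mathbb Z$ with $\mathbf s(k)\in\{0,\dots,\mathbf b(k)-1\}$ for all $k$ and $\mathbf s(k)\to0$ as $k\to+\infty$, with the ultrametric $2^{\max\{k:\mathbf s(k)\ne\mathbf t(k)\}}$ (for $\mathbf s\ne\mathbf t$), and let $\mathbf m_{\mathcal U(\mathbf b)}$ be the Borel measure on it that gives every closed ball of radius $2^n$ the measure $V_{\mathbf b}(2^n)$, $n\in\mathbb Z$. *The tree.* For $m\le n$ let $T_{m,n}$ be the finite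 tree defined as follows. $T_{n,n}$ is a star with $\mathbf b(n)$ leaves and edges of length $2^{n-1}$. $T_{m,n+1}$ is obtained by gluing $\mathbf b(n+1)$ copies of $T_{m,n}$, indexed by $0,\dots,\mathbf b(n+1)-1$, at one leaf $v_n$ (not depending on $m$) that has distance $2^{n-1}$ from the center of $T_{m,n}$ (any choice of such leaves is allowed), with the path metric; it has diameter $2^{n+1}$. Identify $T_{m,n}$ with the copy of index $0$ in $T_{m,n+1}$. Let $m\to-\infty$, $n\to+\infty$ and take the completion; the result is an $\mathbb R$-tree $(\mathcal T(\mathbf b),\mathbf d)$. The completion $\mathcal T_n$ of $\bigcup_{m}T_{m,n}$ and its copies are called $n$-cells; each $n$-cell consists of $\mathbf b(n)$ $(n-1)$-cells indexed by $0,\dots,\mathbf b(n)-1$. Let $\chi:\mathcal U(\mathbf b)\to\mathcal T(\mathbf b)$ map $\mathbf s$ to the point that lies, for every $m\in\mathbb Z$, in the $m$-cell with index $(\mathbf s(m+1),\mathbf s(m+2),\dots)$, and let $\mathbf m=\chi_*\mathbf m_{\mathcal U(\mathbf b)}$. *Length measure, gradient, domain.* Let $[x,y]$ be the geodesic from $x$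 to $y$ in $\mathcal T(\mathbf b)$, let $]x,y[\,=[x,y]\setminus\{x,y\}$, and let $\lambda$ be the length measure, that is, the restriction of the one-dimensional Hausdorff measure to the skeleton $\bigcup_{x,y}]x,y[$. A continuous $f:\mathcal T(\mathbf b)\to\mathbb R$ is locally absolutely continuous if for every $\varepsilon>0$ and every Borel set $S$ with $0<\lambda(S)<\infty$ there is $\delta>0$ such that $\sum_{i=1}^n|f(t_i)-f(s_i)|<\varepsilon$ for all $n\ge1$ and all pairwise disjoint geodesics $[t_1,s_1],\dots,[t_n,s_n]\subseteq S$ with $\sum_{i=1}^n\mathbf d(t_i,s_i)<\delta$. Fix $\rho\in\mathcal T(\mathbf b)$. The gradient $\nabla_{\mathcal T}f$ is the ($\lambda$-a.e. unique) $\lambda$-measurable function $g$ that is $\lambda$-integrable on every geodesic and satisfies $$f(y)-f(x)=\int_{[c,y]}g\,d\lambda-\int_{[c,x]}g\,d\lambda\quad\text{for all }x,y,$$ where $c$ is the point with $[\rho,x]\cap[\rho,y]=[\rho,c]$; $|\nabla_{\mathcal T}f|$ does not depend on $\rho$. Let $\mathcal F^{\mathcal T}$ be the set of all locally absolutely continuous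 $f\in L^p(\mathcal T(\mathbf b);\mathbf m)$ that have a gradient with $\int_{\mathcal T(\mathbf b)}|\nabla_{\mathcal T}f|^p\,d\lambda<\infty$. *Claim.* There exists $C>0$ such that for every ball $B=B(x,r)=\{y:\mathbf d(x,y)<r\}$, $x\in\mathcal T(\mathbf b)$, $r>0$, and every $f\in\mathcal F^{\mathcal T}$, $$\int_B|f-f_B|^p\,d\mathbf m\le C\,r^{p-1}V_{\mathbf b}(r)\int_B|\nabla_{\mathcal T}f|^p\,d\lambda,\qquad f_B=\frac1{\mathbf m(B)}\int_Bf\,d\mathbf m.$$ -/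

import Mathlib

open Filter Topology MeasureTheory
open scoped ENNReal

noncomputable section

namespace LaaksoTree

/-- A branching function `b : ℤ → ℕ` with `2 ≤ inf b ≤ sup b < ∞`. -/
structure BranchingFunction where
  toFun : ℤ → ℕ
  two_le : ∀ k, 2 ≤ toFun k
  bddAbove : BddAbove (Set.range toFun)

instance : CoeFun BranchingFunction (fun _ => ℤ → ℕ) := ⟨BranchingFunction.toFun⟩

instance (b : BranchingFunction) (k : ℤ) : NeZero (b k) :=
  ⟨by have := b.two_le k; omega⟩

/-- The volume function `V_b`. For `r > 0`, the integer `n = Int.log 2 r + 1` is the one with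
`2 ^ (n - 1) ≤ r < 2 ^ n`. For `n = 1` the second branch is the empty product `1`. -/
def BranchingFunction.V (b : BranchingFunction) (r : ℝ) : ℝ :=
  let n : ℤ := Int.log 2 r + 1
  if n ≤ 0 then (∏ k ∈ Finset.Icc n 0, (b k : ℝ))⁻¹
  else ∏ k ∈ Finset.Icc 1 (n - 1), (b k : ℝ)

/-! ### The ultrametric space `U(b)` and its measure -/

/-- The space `U(b)` of all `s : ℤ → ℤ` with `s k ∈ {0, …, b k - 1}` and `s k → 0` as `k → +∞`. -/
def BranchingFunction.U (b : BranchingFunction) : Type :=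
  {s : ℤ → ℕ // (∀ k, s k < b k) ∧ ∀ᶠ k in atTop, s k = 0}

/-- The σ-algebra generated by the coordinates. The closed ball of radius `2 ^ n` about `s` in the
ultrametric `2 ^ max {k : s k ≠ t k}` is the cylinder `{t | ∀ k > n, t k = s k}`, and there are
only countably many of them, so this is the Borel σ-algebra of the ultrametric. -/
instance (b : BranchingFunction) : MeasurableSpace b.U :=
  inferInstanceAs (MeasurableSpace {s : ℤ → ℕ // (∀ k, s k < b k) ∧ ∀ᶠ k in atTop, s k = 0})

/-- The possible values of `(s k)_{k ≥ 1}` for `s ∈ U(b)`, each given by its extension by zero.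
They enumerate the closed balls of radius `1`. -/
def BranchingFunction.Tail (b : BranchingFunction) : Type :=
  {τ : b.U // ∀ k ≤ 0, τ.1 k = 0}

/-- The point of `U(b)` with coordinates `x` at `k ≤ 0` and `τ` at `k ≥ 1`. -/
def BranchingFunction.join (b : BranchingFunction) (τ : b.Tail)
    (x : (k : {k : ℤ // k ≤ 0}) → Fin (b k)) : b.U :=
  ⟨fun k => if h : k ≤ 0 then (x ⟨k, h⟩ : ℕ) else τ.1.1 k, by
    refine ⟨fun k => ?_, ?_⟩
    · by_cases h : k ≤ 0
      · simp [h]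
      · simpa [h] using τ.1.2.1 k
    · filter_upwards [τ.1.2.2, eventually_gt_atTop 0] with k hk hk0
      simpa [not_le.mpr hk0] using hk⟩

/-- The measure on `U(b)` that gives measure `V_b (2 ^ n)` to every closed ball of radius `2 ^ n`:
on each closed ball of radius `1`, it is the product of the uniform probability measures on
the coordinates `k ≤ 0`. -/
def BranchingFunction.measureU (b : BranchingFunction) : Measure b.U :=
  Measure.sum fun τ : b.Tail =>
    (Measure.infinitePi fun k : {k : ℤ // k ≤ 0} =>
      ProbabilityTheory.uniformOn (Set.univ : Set (Fin (b k)))).map (b.join τ)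

/-! ### The tree metric -/

/-- The vertices at which copies are glued. `T_{n+1}` is obtained by gluing `b (n+1)` copies of
`T_n`, indexed by `0, …, b (n+1) - 1`, at a vertex `v_n` of `T_n`, and `vert n k` (`k ≤ n`) is the
index, in the `k`-cell that contains it, of the branch with `v_n` (the values for `k > n` play no
role). Since `T_{n+1}` must have diameter `2 ^ (n+1)`, the vertex `v_n` has distance `2 ^ (n-1)`
from the center of `T_n`, which means that at each level `k < n` it does not lie in the branch
that carries the gluing vertex of the `k`-cell. -/
structure GluingVertices (b : BranchingFunction) where
  vert : ℤ → ℤ → ℕ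
  lt : ∀ n k, vert n k < b k
  ne : ∀ n k, k < n → vert n k ≠ vert k k

instance (b : BranchingFunction) : Inhabited (GluingVertices b) :=
  ⟨{ vert := fun n k => if k = n then 0 else 1
     lt := fun n k => by have := b.two_le k; split_ifs <;> omega
     ne := fun n k h => by simp [h.ne] }⟩

/-- `finDist v N n` is the metric `d_{n-N,n}` of the finite tree `T_{n-N,n}`. The sequence `s`
stands for the following leaf of a copy of a star: `T_{m,n}` (`m = n - N`) is made of copies of
the star `T_{m,m}` with center and `b m` leaves, indexed by `(s (m+1), …, s n)`, and `s` stands for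
the leaf number `s m` in the copy with index `(s (m+1), …, s n)`. On the star `T_{n,n}`, two distinct
leaves have distance `2 ^ n`. On `T_{m,n}` with `m < n`, two points in the same copy of
`T_{m,n-1}` keep their distance, and the distance of two points in distinct copies is measured
through the common vertex `v_{n-1}` of the copies. -/
def finDist (v : ℤ → ℤ → ℕ) : ℕ → ℤ → (ℤ → ℕ) → (ℤ → ℕ) → ℝ
  | 0, n, s, t => if s n = t n then 0 else (2 : ℝ) ^ n
  | N + 1, n, s, t =>
      if s n = t n then finDist v N (n - 1) s t
      else finDist v N (n - 1) s (v (n - 1)) + finDist v N (n - 1) (v (n - 1)) t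

section finDist

variable {b : BranchingFunction} (v : GluingVertices b)

lemma finDist_self (w : ℤ → ℤ → ℕ) (N : ℕ) : ∀ (n : ℤ) (s : ℤ → ℕ), finDist w N n s s = 0 := by
  induction N with
  | zero => intro n s; simp [finDist]
  | succ N ih => intro n s; simp [finDist, ih]

lemma finDist_comm (w : ℤ → ℤ → ℕ) (N : ℕ) :
    ∀ (n : ℤ) (s t : ℤ → ℕ), finDist w N n s t = finDist w N n t s := by
  induction N with
  | zero => intro n s t; simp only [finDist, eq_comm]
  | succ N ih =>
    intro n s t
    simp only [finDist]
    by_cases h : s n = t n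
    · rw [if_pos h, if_pos h.symm, ih]
    · rw [if_neg h, if_neg (Ne.symm h), ih _ s, ih _ _ t, add_comm]

lemma finDist_nonneg (w : ℤ → ℤ → ℕ) (N : ℕ) :
    ∀ (n : ℤ) (s t : ℤ → ℕ), 0 ≤ finDist w N n s t := by
  induction N with
  | zero => intro n s t; simp only [finDist]; split_ifs <;> positivity
  | succ N ih =>
    intro n s t
    simp only [finDist]
    split_ifs
    · exact ih _ _ _
    · exact add_nonneg (ih _ _ _) (ih _ _ _)

lemma finDist_triangle (w : ℤ → ℤ → ℕ) (N : ℕ) : ∀ (n : ℤ) (s t u : ℤ → ℕ),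
    finDist w N n s u ≤ finDist w N n s t + finDist w N n t u := by
  induction N with
  | zero =>
    intro n s t u
    have : (0 : ℝ) < 2 ^ n := by positivity
    simp only [finDist]
    split_ifs <;> first | linarith | omega
  | succ N ih =>
    intro n s t u
    have h0 := finDist_nonneg w N (n - 1)
    have hc := finDist_comm w N (n - 1)
    have h := ih (n - 1)
    simp only [finDist]
    split_ifs with h1 h2 h3 h3 h2 h3 h3
    · exact h _ _ _
    · omega
    · omega
    · linarith [h s (w (n - 1)) u, h0 (w (n - 1)) t, h0 t (w (n - 1))]
    · omega
    · linarith [h s t (w (n - 1))]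
    · linarith [h (w (n - 1)) t u]
    · linarith [h0 (w (n - 1)) t, h0 t (w (n - 1))]

/-- In `T_{m,n}`, the vertex `v_n` has distance `2 ^ n` from the points that, at each level, do not
lie in the branch with the gluing vertex. -/
lemma finDist_vert (N : ℕ) : ∀ (n : ℤ) (s : ℤ → ℕ), (∀ k ≤ n, s k ≠ v.vert k k) →
    finDist v.vert N n s (v.vert n) = 2 ^ n := by
  induction N with
  | zero => intro n s hs; simp [finDist, hs n le_rfl]
  | succ N ih =>
    intro n s hs
    have e : (2 : ℝ) ^ n = 2 ^ (n - 1) + 2 ^ (n - 1) := by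
      rw [← two_mul, zpow_sub_one₀ two_ne_zero]; ring
    simp only [finDist]
    rw [if_neg (hs n le_rfl), ih (n - 1) s (fun k hk => hs k (by omega)),
      finDist_comm, ih (n - 1) _ (fun k hk => v.ne n k (by omega)), e]

lemma finDist_succ_sub_vert (N : ℕ) : ∀ (n : ℤ) (s w : ℤ → ℕ), (∀ k < n, w k ≠ v.vert k k) →
    |finDist v.vert (N + 1) n s w - finDist v.vert N n s w| ≤ 2 ^ (n - N - 1) := by
  induction N with
  | zero =>
    intro n s w hw
    have e : (2 : ℝ) ^ n = 2 ^ (n - 1) + 2 ^ (n - 1) := by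
      rw [← two_mul, zpow_sub_one₀ two_ne_zero]; ring
    have hp : (0 : ℝ) < 2 ^ (n - 1) := by positivity
    have hb : ∀ s t, 0 ≤ finDist v.vert 0 (n - 1) s t ∧
        finDist v.vert 0 (n - 1) s t ≤ 2 ^ (n - 1) := by
      intro s t
      simp only [finDist]
      split_ifs
      · exact ⟨le_rfl, hp.le⟩
      · exact ⟨hp.le, le_rfl⟩
    have hv := finDist_vert v 0 (n - 1) w (fun k hk => hw k (by omega))
    rw [finDist_comm] at hv
    have e1 : finDist v.vert (0 + 1) n s w = if s n = w n then finDist v.vert 0 (n - 1) s w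
      else finDist v.vert 0 (n - 1) s (v.vert (n - 1))
        + finDist v.vert 0 (n - 1) (v.vert (n - 1)) w := rfl
    have e0 : finDist v.vert 0 n s w = if s n = w n then 0 else (2 : ℝ) ^ n := rfl
    rw [e1, e0, hv]
    have b1 := hb s w
    have b2 := hb s (v.vert (n - 1))
    simp only [Nat.cast_zero, sub_zero]
    split_ifs <;> rw [abs_le] <;> constructor <;> linarith [b1.1, b1.2, b2.1, b2.2]
  | succ N ih =>
    intro n s w hw
    have e1 : ∀ M, finDist v.vert (M + 1) n s w = if s n = w n then finDist v.vert M (n - 1) s w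
      else finDist v.vert M (n - 1) s (v.vert (n - 1))
        + finDist v.vert M (n - 1) (v.vert (n - 1)) w := fun _ => rfl
    have hv : ∀ M, finDist v.vert M (n - 1) (v.vert (n - 1)) w = 2 ^ (n - 1) := fun M => by
      rw [finDist_comm]
      exact finDist_vert v M (n - 1) w (fun k hk => hw k (by omega))
    have e : n - ((N + 1 : ℕ) : ℤ) - 1 = n - 1 - N - 1 := by push_cast; ring
    rw [e1, e1, hv, hv, e]
    split_ifs
    · exact ih (n - 1) s w (fun k hk => hw k (by omega))
    · simpa using ih (n - 1) s (v.vert (n - 1)) (fun k hk => v.ne _ k hk)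

lemma finDist_succ_sub (N : ℕ) : ∀ (n : ℤ) (s t : ℤ → ℕ),
    |finDist v.vert (N + 1) n s t - finDist v.vert N n s t| ≤ 2 ^ (n - N) := by
  induction N with
  | zero =>
    intro n s t
    have e : (2 : ℝ) ^ n = 2 ^ (n - 1) + 2 ^ (n - 1) := by
      rw [← two_mul, zpow_sub_one₀ two_ne_zero]; ring
    have hp : (0 : ℝ) < 2 ^ (n - 1) := by positivity
    have hb : ∀ s t, 0 ≤ finDist v.vert 0 (n - 1) s t ∧
        finDist v.vert 0 (n - 1) s t ≤ 2 ^ (n - 1) := by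
      intro s t
      simp only [finDist]
      split_ifs
      · exact ⟨le_rfl, hp.le⟩
      · exact ⟨hp.le, le_rfl⟩
    have e1 : finDist v.vert (0 + 1) n s t = if s n = t n then finDist v.vert 0 (n - 1) s t
      else finDist v.vert 0 (n - 1) s (v.vert (n - 1))
        + finDist v.vert 0 (n - 1) (v.vert (n - 1)) t := rfl
    have e0 : finDist v.vert 0 n s t = if s n = t n then 0 else (2 : ℝ) ^ n := rfl
    rw [e1, e0]
    have b1 := hb s t
    have b2 := hb s (v.vert (n - 1))
    have b3 := hb (v.vert (n - 1)) t
    simp only [Nat.cast_zero, sub_zero]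
    split_ifs <;> rw [abs_le] <;> constructor <;>
      linarith [b1.1, b1.2, b2.1, b2.2, b3.1, b3.2]
  | succ N ih =>
    intro n s t
    have e1 : ∀ M, finDist v.vert (M + 1) n s t = if s n = t n then finDist v.vert M (n - 1) s t
      else finDist v.vert M (n - 1) s (v.vert (n - 1))
        + finDist v.vert M (n - 1) (v.vert (n - 1)) t := fun _ => rfl
    have e : n - ((N + 1 : ℕ) : ℤ) = n - 1 - N := by push_cast; ring
    rw [e1, e1, e]
    split_ifs
    · exact ih (n - 1) s t
    · have h1 := finDist_succ_sub_vert v N (n - 1) s (v.vert (n - 1)) (fun k hk => v.ne _ k hk)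
      have h2 := finDist_succ_sub_vert v N (n - 1) t (v.vert (n - 1)) (fun k hk => v.ne _ k hk)
      rw [finDist_comm v.vert (N + 1) _ (v.vert (n - 1)) t,
        finDist_comm v.vert N _ (v.vert (n - 1)) t]
      have e2 : (2 : ℝ) ^ (n - 1 - (N : ℤ)) = 2 ^ (n - 1 - (N : ℤ) - 1) + 2 ^ (n - 1 - (N : ℤ) - 1) := by
        rw [← two_mul, zpow_sub_one₀ two_ne_zero]; ring
      rw [e2]
      rw [abs_le] at *
      constructor <;> linarith [h1.1, h1.2, h2.1, h2.2]

lemma finDist_top (w : ℤ → ℤ → ℕ) (M j : ℕ) (n : ℤ) (s t : ℤ → ℕ) (h : ∀ k > n, s k = t k) :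
    finDist w (M + j) (n + j) s t = finDist w M n s t := by
  induction j with
  | zero => simp
  | succ j ih =>
    have e : n + ((j + 1 : ℕ) : ℤ) - 1 = n + j := by push_cast; ring
    rw [← add_assoc, finDist, if_pos (h _ (by push_cast; omega)), e, ih]

lemma exists_forall_gt_eq (s t : b.U) : ∃ n : ℕ, ∀ k > (n : ℤ), s.1 k = t.1 k := by
  obtain ⟨a, ha⟩ := eventually_atTop.1 (s.2.2.and t.2.2)
  refine ⟨a.toNat, fun k hk => ?_⟩
  have := ha k (by omega)
  rw [this.1, this.2]

/-- The distances in `T_{-N,N}` converge as `N → ∞`. -/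
lemma exists_tendsto_finDist (s t : b.U) :
    ∃ d, Tendsto (fun N : ℕ => finDist v.vert (2 * N) N s.1 t.1) atTop (𝓝 d) := by
  obtain ⟨n, hn⟩ := exists_forall_gt_eq s t
  have hc : CauchySeq fun N : ℕ => finDist v.vert N n s.1 t.1 := by
    refine cauchySeq_of_le_geometric (1 / 2) (2 ^ n) (by norm_num) fun N => ?_
    rw [dist_comm, Real.dist_eq]
    refine (finDist_succ_sub v N n s.1 t.1).trans_eq ?_
    rw [zpow_sub₀ two_ne_zero, zpow_natCast, zpow_natCast, one_div, inv_pow, div_eq_mul_inv]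
  obtain ⟨d, hd⟩ := cauchySeq_tendsto_of_complete hc
  refine ⟨d, (hd.comp (tendsto_add_atTop_nat n)).congr' ?_⟩
  filter_upwards [eventually_ge_atTop n] with N hN
  obtain ⟨j, rfl⟩ := Nat.exists_eq_add_of_le hN
  have := finDist_top v.vert (n + j + n) j n s.1 t.1 hn
  simp only [Function.comp_apply]
  rw [← this]
  congr 1
  ring

end finDist

variable {b : BranchingFunction} (v : GluingVertices b)

/-- The limit `d_{-∞,+∞}` of the metrics `d_{-N,N}` as `N → ∞`. -/
def limDist (s t : b.U) : ℝ :=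
  limUnder atTop fun N : ℕ => finDist v.vert (2 * N) N s.1 t.1

lemma tendsto_limDist (s t : b.U) :
    Tendsto (fun N : ℕ => finDist v.vert (2 * N) N s.1 t.1) atTop (𝓝 (limDist v s t)) :=
  tendsto_nhds_limUnder (exists_tendsto_finDist v s t)

/-- The points of `U(b)` as addresses of points of the tree, with the limit pseudometric. -/
def PreTree (_v : GluingVertices b) : Type := b.U

instance : PseudoMetricSpace (PreTree v) where
  dist s t := limDist v s t
  dist_self s := tendsto_nhds_unique (tendsto_limDist v s s) (by simp [finDist_self])
  dist_comm s t := tendsto_nhds_unique (tendsto_limDist v s t)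
    (by simpa only [finDist_comm v.vert _ _ s.1 t.1] using tendsto_limDist v t s)
  dist_triangle s t u := le_of_tendsto_of_tendsto' (tendsto_limDist v s u)
    ((tendsto_limDist v s t).add (tendsto_limDist v t u))
    fun _ => finDist_triangle _ _ _ _ _ _

/-- The `ℝ`-tree `T(b)`: the completion of the limit of the finite trees. -/
def Tree : Type := UniformSpace.Completion (PreTree v)

instance : MetricSpace (Tree v) :=
  inferInstanceAs (MetricSpace (UniformSpace.Completion (PreTree v)))

instance : MeasurableSpace (Tree v) := borel _

instance : BorelSpace (Tree v) := ⟨rfl⟩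

/-- The projection `χ : U(b) → T(b)`. The point `χ s` is the one that lies, for all `m`, in the
`m`-cell with index `(s (m+1), s (m+2), …)`. -/
def proj (s : b.U) : Tree v := UniformSpace.Completion.coe' (α := PreTree v) s

/-- The measure on `T(b)`: the pushforward under `χ` of the measure on `U(b)`. -/
def treeMeasure : Measure (Tree v) := b.measureU.map (proj v)

/-! ### Geodesics, length measure, gradient, domain -/

variable {v}

/-- The geodesic `[x, y]`. In an `ℝ`-tree, it consists of the points between `x` and `y`. -/
def geodesic (x y : Tree v) : Set (Tree v) := {z | dist x z + dist z y = dist x y}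

/-- The open geodesic `]x, y[ = [x, y] \ {x, y}`. -/
def openGeodesic (x y : Tree v) : Set (Tree v) := geodesic x y \ {x, y}

variable (v) in
/-- The skeleton of the tree: the union of all open geodesics. -/
def skeleton : Set (Tree v) := ⋃ (x : Tree v) (y : Tree v), openGeodesic x y

variable (v) in
/-- The length measure: the trace on the skeleton of the one-dimensional Hausdorff measure. -/
def lengthMeasure : Measure (Tree v) := (μH[1] : Measure (Tree v)).restrict (skeleton v)

/-- Locally absolutely continuous functions on the tree. -/
structure LocallyAC (f : Tree v → ℝ) : Prop where
  continuous : Continuous f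
  abs_cont : ∀ ε : ℝ, 0 < ε → ∀ S : Set (Tree v), MeasurableSet S →
    0 < lengthMeasure v S → lengthMeasure v S < ∞ →
    ∃ δ : ℝ, 0 < δ ∧ ∀ (n : ℕ) (s t : Fin n → Tree v), 1 ≤ n →
      (Pairwise fun i j => Disjoint (geodesic (s i) (t i)) (geodesic (s j) (t j))) →
      (∀ i, geodesic (s i) (t i) ⊆ S) → ∑ i, dist (s i) (t i) < δ →
      ∑ i, |f (s i) - f (t i)| < ε

/-- `g` is the gradient of `f` with respect to the root `ρ`: it is measurable, integrable on the
geodesics, and `f y - f x` is the oriented integral `∫_x^y g`, that is, the integral of `g` on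
`[c, y]` minus that on `[c, x]`, where `c` is the branch point with `[ρ, x] ∩ [ρ, y] = [ρ, c]`. -/
structure IsGradient (ρ : Tree v) (f g : Tree v → ℝ) : Prop where
  measurable : AEStronglyMeasurable g (lengthMeasure v)
  integrableOn : ∀ x y, IntegrableOn g (geodesic x y) (lengthMeasure v)
  sub_eq : ∀ x y, ∃ c, geodesic ρ x ∩ geodesic ρ y = geodesic ρ c ∧
    f y - f x = ∫ z in geodesic c y, g z ∂lengthMeasure v
      - ∫ z in geodesic c x, g z ∂lengthMeasure v

/-- The domain of the `p`-energy: the locally absolutely continuous functions in `L^p`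
whose gradient is in `L^p` of the length measure. -/
structure MemDomain (p : ℝ) (ρ : Tree v) (f : Tree v → ℝ) : Prop where
  memLp : MemLp f (ENNReal.ofReal p) (treeMeasure v)
  locallyAC : LocallyAC f
  exists_gradient : ∃ g, IsGradient ρ f g ∧
    ∫⁻ z, ENNReal.ofReal (|g z| ^ p) ∂lengthMeasure v < ∞

end LaaksoTree

end

namespace LaaksoTree

/-! ### The finite trees: four-point condition and medians -/

/-! On a tree the inequality follows from a pointwise oscillation bound. For `x`, `y` in a ball `B`
of radius `r`, the difference `f y - f x` is a difference of integrals of `g` over `[c, y]` and `[c,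
x]`, where `c` is the branch point. Balls are geodesically convex and `c` lies on `[x, y]`, so both
pieces stay in `B` and have length at most `2r`. Hölder's inequality gives `|f y - f x| ≤ 2 (∫_B
|g|^p)^(1/p) (2r)^(1-1/p)`. The same bound holds with `f x` replaced by the mean over `B`; taking
`p`-th powers and integrating produces the factor `m(B)`, which is at most a constant times `V(r)`.

Two geometric inputs carry this. First, the metric is that of a tree: the four-point condition
(`dist_fourPoint`) and exact medians (`exists_isMedian`) are proved for the finite trees by
induction over the gluing, medians only up to the size of the smallest stars, and then passed to the
limit and the completion. They yield convexity of balls, the position of the branch point, and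
`λ([x, y]) ≤ d(x, y)`.

Second, `treeMeasure_ball_le`: a ball of radius comparable to `2^n` meets boundedly many `n`-cells.
Cells that are close but distinct are joined through one gluing vertex, and the defining condition
`GluingVertices.ne` leaves at most one level above `n + 1` at which this can happen near a given
point. -/

lemma finDist_congr (w : ℤ → ℤ → ℕ) (N : ℕ) : ∀ (n : ℤ) {s s' t t' : ℤ → ℕ},
    (∀ k ≤ n, s k = s' k) → (∀ k ≤ n, t k = t' k) → finDist w N n s t = finDist w N n s' t' := by
  induction N with
  | zero => intro n s s' t t' hs ht; simp only [finDist, hs n le_rfl, ht n le_rfl]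
  | succ N ih =>
    intro n s s' t t' hs ht
    have hs' : ∀ k ≤ n - 1, s k = s' k := fun k hk => hs k (by omega)
    have ht' : ∀ k ≤ n - 1, t k = t' k := fun k hk => ht k (by omega)
    simp only [finDist, hs n le_rfl, ht n le_rfl]
    rw [ih _ hs' ht', ih (n - 1) hs' (fun _ _ => rfl), ih (n - 1) (fun _ _ => rfl) ht']

/-- Gluing trees at one vertex preserves the condition. If exactly one point lies off the branch of
the other three, it may be replaced by the gluing vertex; if the points are spread out further, all
mixed distances split at that vertex and triangle inequalities suffice. -/
lemma finDist_fourPoint (w : ℤ → ℤ → ℕ) (N : ℕ) : ∀ (n : ℤ) (x y z u : ℤ → ℕ),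
    finDist w N n x y + finDist w N n z u ≤
      max (finDist w N n x z + finDist w N n y u) (finDist w N n x u + finDist w N n y z) := by
  induction N with
  | zero =>
    intro n x y z u
    have hp : (0 : ℝ) < 2 ^ n := by positivity
    simp only [finDist, le_max_iff]
    split_ifs <;> first | omega | (left; linarith) | (right; linarith)
  | succ N ih =>
    intro n x y z u
    have tri := finDist_triangle w N (n - 1)
    have hc := finDist_comm w N (n - 1) (w (n - 1))
    have h := ih (n - 1)
    simp only [le_max_iff] at h ⊢
    simp only [finDist, hc]
    have txy := tri x (w (n - 1)) y
    have txz := tri x (w (n - 1)) z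
    have txu := tri x (w (n - 1)) u
    have tyz := tri y (w (n - 1)) z
    have tyu := tri y (w (n - 1)) u
    have tzu := tri z (w (n - 1)) u
    rw [hc] at txy txz txu tyz tyu tzu
    -- `h1` serves four points in one branch; `h2` to `h5` replace `u`, `z`, `y`, `x` in turn by the
    -- gluing vertex.
    have h1 := h x y z u
    have h2 := h x y z (w (n - 1))
    have h3 := h x y (w (n - 1)) u
    have h4 := h x (w (n - 1)) z u
    have h5 := h (w (n - 1)) y z u
    simp only [hc] at h3 h4 h5
    clear tri hc h ih
    split_ifs <;> first
      | omega
      | (left; linarith)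
      | (right; linarith)
      | (rcases h2 with h1 | h1 <;> first | (left; linarith) | (right; linarith))
      | (rcases h3 with h1 | h1 <;> first | (left; linarith) | (right; linarith))
      | (rcases h4 with h1 | h1 <;> first | (left; linarith) | (right; linarith))
      | (rcases h5 with h1 | h1 <;> first | (left; linarith) | (right; linarith))

/-- `c` is a median of `x`, `y`, `z` for `d` up to the error `ε`. -/
def IsApproxMedian {α : Type*} (d : α → α → ℝ) (ε : ℝ) (x y z c : α) : Prop :=
  d x c + d y c ≤ d x y + ε ∧ d x c + d z c ≤ d x z + ε ∧ d y c + d z c ≤ d y z + ε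

lemma IsApproxMedian.rotate {α : Type*} {d : α → α → ℝ} (hd : ∀ x y, d x y = d y x) {ε : ℝ}
    {x y z c : α} (h : IsApproxMedian d ε x y z c) : IsApproxMedian d ε y z x c := by
  obtain ⟨h1, h2, h3⟩ := h
  refine ⟨h3, ?_, ?_⟩
  · rw [hd y x]; linarith
  · rw [hd z x]; linarith

variable {b : BranchingFunction} (v : GluingVertices b)

/-- The addresses see only leaves of the stars `T_{m,m}`, `m = n - N`, not their centers, so three
distinct leaves of a star have a median only up to its diameter `2^m`. -/
lemma exists_isApproxMedian_finDist (N : ℕ) : ∀ (n : ℤ) (x y z : ℤ → ℕ),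
    (∀ k, x k < b k) → (∀ k, y k < b k) → (∀ k, z k < b k) →
    ∃ c : ℤ → ℕ, (∀ k, c k < b k) ∧ IsApproxMedian (finDist v.vert N n) (2 ^ (n - N)) x y z c := by
  induction N with
  | zero =>
    intro n x y z hx hy hz
    have hp : (0 : ℝ) < 2 ^ n := by positivity
    simp only [IsApproxMedian, finDist, Nat.cast_zero, sub_zero]
    by_cases h : y n = z n
    · refine ⟨y, hy, ?_, ?_, ?_⟩ <;> split_ifs <;> first | omega | linarith
    · refine ⟨x, hx, ?_, ?_, ?_⟩ <;> split_ifs <;> first | omega | linarith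
  | succ N ih =>
    have hcomm := fun n => finDist_comm v.vert (N + 1) n
    have key : ∀ (n : ℤ) (x y z : ℤ → ℕ),
        (∀ k, x k < b k) → (∀ k, y k < b k) → (∀ k, z k < b k) → x n = y n →
        ∃ c : ℤ → ℕ, (∀ k, c k < b k) ∧
          IsApproxMedian (finDist v.vert (N + 1) n) (2 ^ (n - (N + 1 : ℕ))) x y z c := by
      intro n x y z hx hy hz hxy
      -- Seen from the branch of `x` and `y`, a third point in another branch sits at the gluing
      -- vertex.
      obtain ⟨c, hc, h1, h2, h3⟩ := ih (n - 1) x y (if x n = z n then z else v.vert (n - 1)) hx hy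
        (by split_ifs; exacts [hz, v.lt _])
      have e : n - ((N + 1 : ℕ) : ℤ) = n - 1 - N := by push_cast; ring
      have hcong : ∀ s, finDist v.vert N (n - 1) s (Function.update c n (x n)) =
          finDist v.vert N (n - 1) s c := fun s =>
        finDist_congr _ _ _ (fun _ _ => rfl)
          (fun k hk => Function.update_of_ne (by omega) _ _)
      refine ⟨Function.update c n (x n), fun k => ?_, ?_⟩
      · by_cases hk : k = n
        · subst hk; simpa using hx k
        · simpa [Function.update_of_ne hk] using hc k
      · simp only [IsApproxMedian, finDist, e, hcong, Function.update_self, ← hxy, if_true]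
        by_cases hz' : x n = z n
        · simp only [← hz', if_true] at h1 h2 h3 ⊢
          exact ⟨h1, h2, h3⟩
        · simp only [if_neg hz', if_neg (Ne.symm hz')] at h1 h2 h3 ⊢
          rw [finDist_comm _ _ _ z (v.vert (n - 1))]
          exact ⟨h1, by linarith, by linarith⟩
    intro n x y z hx hy hz
    by_cases hxy : x n = y n
    · exact key n x y z hx hy hz hxy
    by_cases hyz : y n = z n
    · obtain ⟨c, hc, h⟩ := key n y z x hy hz hx hyz
      exact ⟨c, hc, (h.rotate (hcomm n)).rotate (hcomm n)⟩
    by_cases hzx : z n = x n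
    · obtain ⟨c, hc, h⟩ := key n z x y hz hx hy hzx
      exact ⟨c, hc, h.rotate (hcomm n)⟩
    have hp : (0 : ℝ) < 2 ^ (n - ((N + 1 : ℕ) : ℤ)) := by positivity
    have hcong : ∀ s, finDist v.vert N (n - 1) s (Function.update (v.vert (n - 1)) n (x n)) =
        finDist v.vert N (n - 1) s (v.vert (n - 1)) := fun s =>
      finDist_congr _ _ _ (fun _ _ => rfl) (fun k hk => Function.update_of_ne (by omega) _ _)
    -- With three distinct branches the gluing vertex is an exact median; coordinate `n` merely
    -- names one of its copies.
    refine ⟨Function.update (v.vert (n - 1)) n (x n), fun k => ?_, ?_⟩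
    · by_cases hk : k = n
      · subst hk; simpa using hx k
      · simpa [Function.update_of_ne hk] using v.lt (n - 1) k
    · simp only [IsApproxMedian, finDist, hcong, Function.update_self, if_neg hxy, if_neg hyz,
        if_neg hzx, if_neg (Ne.symm hxy), if_neg (Ne.symm hzx), if_true, finDist_self,
        finDist_comm v.vert N (n - 1) (v.vert (n - 1))]
      exact ⟨by linarith, by linarith, by linarith⟩

/-! ### The limit pseudometric -/

lemma tendsto_finDist_limDist {n : ℤ} {s t : b.U} (h : ∀ k > n, s.1 k = t.1 k) :
    Tendsto (fun M : ℕ => finDist v.vert M n s.1 t.1) atTop (𝓝 (limDist v s t)) := by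
  have hc : CauchySeq fun N : ℕ => finDist v.vert N n s.1 t.1 := by
    refine cauchySeq_of_le_geometric (1 / 2) (2 ^ n) (by norm_num) fun N => ?_
    rw [dist_comm, Real.dist_eq]
    refine (finDist_succ_sub v N n s.1 t.1).trans_eq ?_
    rw [zpow_sub₀ two_ne_zero, zpow_natCast, one_div, inv_pow, div_eq_mul_inv]
  obtain ⟨d, hd⟩ := cauchySeq_tendsto_of_complete hc
  -- Level `n` with depth `N + n` and level `N` with depth `2N` both have stars of level `-N`, so
  -- the two distances agree once `N` is large.
  have hM : Tendsto (fun N : ℕ => ((N : ℤ) + n).toNat) atTop atTop := by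
    refine tendsto_atTop.2 fun a => ?_
    filter_upwards [eventually_ge_atTop (a + n.natAbs)] with N hN
    omega
  have : Tendsto (fun N : ℕ => finDist v.vert (2 * N) N s.1 t.1) atTop (𝓝 d) := by
    refine (hd.comp hM).congr' ?_
    filter_upwards [eventually_ge_atTop n.natAbs] with N hN
    have := finDist_top v.vert ((N : ℤ) + n).toNat ((N : ℤ) - n).toNat n s.1 t.1 h
    simp only [Function.comp_apply]
    rw [← this]
    congr 1 <;> omega
  rwa [tendsto_nhds_unique (tendsto_limDist v s t) this]

lemma abs_finDist_sub_limDist_le {n : ℤ} {s t : b.U} (h : ∀ k > n, s.1 k = t.1 k) (M : ℕ) :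
    |finDist v.vert M n s.1 t.1 - limDist v s t| ≤ 2 * 2 ^ (n - M) := by
  have := dist_le_of_le_geometric_two_of_tendsto (C := 2 * 2 ^ n)
    (f := fun M : ℕ => finDist v.vert M n s.1 t.1) (fun N => ?_) (tendsto_finDist_limDist v h) M
  · rw [Real.dist_eq] at this
    rwa [zpow_sub₀ two_ne_zero, zpow_natCast, ← mul_div_assoc]
  · rw [dist_comm, Real.dist_eq]
    refine (finDist_succ_sub v N n s.1 t.1).trans_eq ?_
    rw [zpow_sub₀ two_ne_zero, zpow_natCast]
    ring

lemma limDist_fourPoint (x y z u : b.U) : limDist v x y + limDist v z u ≤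
    max (limDist v x z + limDist v y u) (limDist v x u + limDist v y z) :=
  le_of_tendsto_of_tendsto' ((tendsto_limDist v x y).add (tendsto_limDist v z u))
    (((tendsto_limDist v x z).add (tendsto_limDist v y u)).max
      ((tendsto_limDist v x u).add (tendsto_limDist v y z)))
    fun _ => finDist_fourPoint _ _ _ _ _ _ _

lemma exists_isApproxMedian_limDist (x y z : b.U) {ε : ℝ} (hε : 0 < ε) :
    ∃ c : b.U, IsApproxMedian (limDist v) ε x y z c := by
  obtain ⟨n₁, h₁⟩ := exists_forall_gt_eq x y
  obtain ⟨n₂, h₂⟩ := exists_forall_gt_eq x z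
  set n : ℤ := max n₁ n₂
  have hxy : ∀ k > n, x.1 k = y.1 k := fun k hk => h₁ k (by omega)
  have hxz : ∀ k > n, x.1 k = z.1 k := fun k hk => h₂ k (by omega)
  -- One unit of median error plus two units for each of three distances replaced by their limits
  -- make `7`.
  obtain ⟨M, hM⟩ : ∃ M : ℕ, (2 : ℝ) ^ (n - M) < ε / 7 := by
    obtain ⟨M, hM⟩ := exists_pow_lt_of_lt_one (show 0 < ε / 7 / 2 ^ n by positivity)
      (show (1 / 2 : ℝ) < 1 by norm_num)
    refine ⟨M, ?_⟩
    rw [lt_div_iff₀ (by positivity)] at hM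
    rwa [zpow_sub₀ two_ne_zero, zpow_natCast, div_eq_mul_inv, mul_comm, ← inv_pow, ← one_div]
  obtain ⟨c₀, hc₀, h⟩ := exists_isApproxMedian_finDist v M n x.1 y.1 z.1 x.2.1 y.2.1 z.2.1
  -- Only coordinates up to `n` affect the finite distance; those of `x` above `n` make the address
  -- eventually zero.
  let c : b.U := ⟨fun k => if k ≤ n then c₀ k else x.1 k, fun k => by
    dsimp only; split_ifs; exacts [hc₀ k, x.2.1 k], by
    filter_upwards [x.2.2, eventually_gt_atTop n] with k hk hkn
    rw [if_neg (not_le.2 hkn), hk]⟩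
  have hc : ∀ k > n, x.1 k = c.1 k := fun k hk => (if_neg (not_le.2 hk)).symm
  have hcong : ∀ s : ℤ → ℕ, finDist v.vert M n s c₀ = finDist v.vert M n s c.1 := fun s =>
    finDist_congr _ _ _ (fun _ _ => rfl) fun k hk => (if_pos hk).symm
  have e : ∀ s t : b.U, (∀ k > n, x.1 k = s.1 k) → (∀ k > n, x.1 k = t.1 k) →
      |finDist v.vert M n s.1 t.1 - limDist v s t| ≤ 2 * 2 ^ (n - (M : ℤ)) := fun s t hs ht =>
    abs_finDist_sub_limDist_le v (fun k hk => (hs k hk).symm.trans (ht k hk)) M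
  have hx : ∀ k > n, x.1 k = x.1 k := fun _ _ => rfl
  obtain ⟨m1, m2, m3⟩ := h
  rw [hcong, hcong] at m1 m2 m3
  have e1 := abs_le.1 (e x c hx hc)
  have e2 := abs_le.1 (e y c hxy hc)
  have e3 := abs_le.1 (e z c hxz hc)
  have e4 := abs_le.1 (e x y hx hxy)
  have e5 := abs_le.1 (e x z hx hxz)
  have e6 := abs_le.1 (e y z hxy hxz)
  exact ⟨c, by linarith [e1.1, e2.1, e4.2], by linarith [e1.1, e3.1, e5.2],
    by linarith [e2.1, e3.1, e6.2]⟩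

/-! ### The tree: geodesics and balls -/

variable {v}

lemma dist_proj (s t : b.U) : dist (proj v s) (proj v t) = limDist v s t :=
  UniformSpace.Completion.dist_eq (α := PreTree v) s t

lemma dist_fourPoint (x y z u : Tree v) :
    dist x y + dist z u ≤ max (dist x z + dist y u) (dist x u + dist y z) := by
  have key : ∀ x y z u : b.U, dist (proj v x) (proj v y) + dist (proj v z) (proj v u) ≤
      max (dist (proj v x) (proj v z) + dist (proj v y) (proj v u))
        (dist (proj v x) (proj v u) + dist (proj v y) (proj v z)) := by
    simp only [dist_proj]
    exact limDist_fourPoint v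
  refine UniformSpace.Completion.induction_on₂ (α := PreTree v) (β := PreTree v)
    (p := fun x y : Tree v =>
      dist x y + dist z u ≤ max (dist x z + dist y u) (dist x u + dist y z)) x y ?_ fun x y => ?_
  · change IsClosed {q : Tree v × Tree v | dist q.1 q.2 + dist z u ≤
      max (dist q.1 z + dist q.2 u) (dist q.1 u + dist q.2 z)}
    exact isClosed_le (by fun_prop) (by fun_prop)
  refine UniformSpace.Completion.induction_on₂ (α := PreTree v) (β := PreTree v)
    (p := fun z u : Tree v => dist (proj v x) (proj v y) + dist z u ≤
      max (dist (proj v x) z + dist (proj v y) u) (dist (proj v x) u + dist (proj v y) z)) z u ?_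
    fun z u => ?_
  · change IsClosed {q : Tree v × Tree v | dist (proj v x) (proj v y) + dist q.1 q.2 ≤
      max (dist (proj v x) q.1 + dist (proj v y) q.2)
        (dist (proj v x) q.2 + dist (proj v y) q.1)}
    exact isClosed_le (by fun_prop) (by fun_prop)
  exact key x y z u

lemma exists_dist_proj_lt (x : Tree v) {ε : ℝ} (hε : 0 < ε) : ∃ s : b.U, dist x (proj v s) < ε :=
  Metric.denseRange_iff.1 (UniformSpace.Completion.denseRange_coe (α := PreTree v)) x ε hε

lemma exists_isApproxMedian (x y z : Tree v) {ε : ℝ} (hε : 0 < ε) :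
    ∃ c : Tree v, IsApproxMedian dist ε x y z c := by
  -- Each inequality uses four replacements of a point by a nearby address and one median error.
  have hε' : 0 < ε / 5 := by positivity
  obtain ⟨x', hx⟩ := exists_dist_proj_lt x hε'
  obtain ⟨y', hy⟩ := exists_dist_proj_lt y hε'
  obtain ⟨z', hz⟩ := exists_dist_proj_lt z hε'
  obtain ⟨c, h1, h2, h3⟩ := exists_isApproxMedian_limDist v x' y' z' hε'
  simp only [← dist_proj] at h1 h2 h3
  have tx := dist_triangle x (proj v x') (proj v c)
  have ty := dist_triangle y (proj v y') (proj v c)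
  have tz := dist_triangle z (proj v z') (proj v c)
  have txy := dist_triangle4 (proj v x') x y (proj v y')
  have txz := dist_triangle4 (proj v x') x z (proj v z')
  have tyz := dist_triangle4 (proj v y') y z (proj v z')
  rw [dist_comm (proj v x') x] at txy txz
  rw [dist_comm (proj v y') y] at tyz
  exact ⟨proj v c, by linarith, by linarith, by linarith⟩

/-- By the four-point condition, approximate medians are close to each other. -/
lemma IsApproxMedian.dist_le {x y z c c' : Tree v} {ε : ℝ} (h : IsApproxMedian dist ε x y z c)
    (h' : IsApproxMedian dist ε x y z c') : dist c c' ≤ 3 * ε := by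
  obtain ⟨h1, h2, h3⟩ := h
  obtain ⟨h1', h2', h3'⟩ := h'
  have t1 := dist_triangle_right x y c
  have t2 := dist_triangle_right x z c
  have t3 := dist_triangle_right y z c
  have t1' := dist_triangle_right x y c'
  have t2' := dist_triangle_right x z c'
  have t3' := dist_triangle_right y z c'
  -- The distances from `x`, `y`, `z` to either approximate median exceed the Gromov products by at
  -- most `ε`, so both sums in the maximum are at most `dist x y + 2 * ε`.
  rcases le_max_iff.1 (dist_fourPoint x y c c') with h | h <;> linarith

/-- Approximate medians with errors tending to zero form a Cauchy sequence, and the tree is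
complete. -/
lemma exists_isMedian (x y z : Tree v) : ∃ c : Tree v, IsApproxMedian dist 0 x y z c := by
  choose c hc using fun n : ℕ => exists_isApproxMedian x y z (ε := 1 / ((n : ℝ) + 1)) (by positivity)
  have hmono : ∀ {n m : ℕ}, n ≤ m → IsApproxMedian dist (1 / ((n : ℝ) + 1)) x y z (c m) := by
    intro n m hnm
    obtain ⟨h1, h2, h3⟩ := hc m
    have := one_div_le_one_div_of_le (by positivity : (0 : ℝ) < n + 1)
      (by gcongr : (n : ℝ) + 1 ≤ m + 1)
    exact ⟨by linarith, by linarith, by linarith⟩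
  have hlim : Tendsto (fun n : ℕ => 1 / ((n : ℝ) + 1)) atTop (𝓝 0) :=
    tendsto_one_div_add_atTop_nhds_zero_nat
  have hcau : CauchySeq c := cauchySeq_of_le_tendsto_0' (fun n : ℕ => 3 * (1 / ((n : ℝ) + 1)))
    (fun n m hnm => (hc n).dist_le (hmono hnm)) (by simpa using hlim.const_mul 3)
  have : CompleteSpace (Tree v) :=
    inferInstanceAs (CompleteSpace (UniformSpace.Completion (PreTree v)))
  obtain ⟨a, ha⟩ := cauchySeq_tendsto_of_complete hcau
  have hd : ∀ w : Tree v, Tendsto (fun n => dist w (c n)) atTop (𝓝 (dist w a)) := fun w =>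
    tendsto_const_nhds.dist ha
  exact ⟨a, le_of_tendsto_of_tendsto' ((hd x).add (hd y)) (hlim.const_add _) fun n => (hc n).1,
    le_of_tendsto_of_tendsto' ((hd x).add (hd z)) (hlim.const_add _) fun n => (hc n).2.1,
    le_of_tendsto_of_tendsto' ((hd y).add (hd z)) (hlim.const_add _) fun n => (hc n).2.2⟩

/-- The branch point of `x` and `y` seen from any root lies on the geodesic `[x, y]`. -/
lemma mem_geodesic_of_inter_eq {ρ x y c : Tree v}
    (h : geodesic ρ x ∩ geodesic ρ y = geodesic ρ c) : c ∈ geodesic x y := by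
  -- The median `a` belongs to both geodesics from `ρ`, hence to `[ρ, c]`; so `c` is at least as far
  -- along `[ρ, x]` and `[ρ, y]` as `a`, while `a` is between `x` and `y`.
  obtain ⟨a, h1, h2, h3⟩ := exists_isMedian ρ x y
  have ha : a ∈ geodesic ρ c := by
    rw [← h]
    refine ⟨le_antisymm ?_ (dist_triangle _ _ _), le_antisymm ?_ (dist_triangle _ _ _)⟩
    · rw [dist_comm a x]; linarith
    · rw [dist_comm a y]; linarith
  have hc : c ∈ geodesic ρ x ∩ geodesic ρ y := by
    rw [h]; simp [geodesic]
  obtain ⟨hx, hy⟩ := hc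
  simp only [geodesic, Set.mem_ofPred_eq] at ha hx hy ⊢
  refine le_antisymm ?_ (dist_triangle _ _ _)
  have := dist_nonneg (x := a) (y := c)
  have t1 := dist_triangle ρ a x
  have t2 := dist_triangle ρ a y
  rw [dist_comm a x] at t1
  rw [dist_comm a y] at t2
  rw [dist_comm x c]
  linarith

/-- Splitting `dist x y` at `z` in the four-point condition leaves `dist z w` below `dist y w - dist
z y` or `dist x w - dist x z`. -/
lemma dist_le_max_of_mem_geodesic {x y z : Tree v} (w : Tree v) (hz : z ∈ geodesic x y) :
    dist z w ≤ max (dist x w) (dist y w) := by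
  simp only [geodesic, Set.mem_ofPred_eq] at hz
  rw [le_max_iff]
  have := dist_nonneg (x := x) (y := z)
  have := dist_nonneg (x := z) (y := y)
  rcases le_max_iff.1 (dist_fourPoint x y z w) with h | h
  · right; linarith
  · left; rw [dist_comm y z] at h; linarith

/-- Balls are geodesically convex. -/
lemma geodesic_subset_ball {x y a : Tree v} {r : ℝ} (hx : x ∈ Metric.ball a r)
    (hy : y ∈ Metric.ball a r) : geodesic x y ⊆ Metric.ball a r := fun _ hz =>
  (dist_le_max_of_mem_geodesic a hz).trans_lt (max_lt hx hy)

lemma dist_eq_of_mem_geodesic {x y z w : Tree v} (hz : z ∈ geodesic x y)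
    (hw : w ∈ geodesic x y) : dist z w = |dist x z - dist x w| := by
  refine le_antisymm ?_ (by simpa [dist_comm] using abs_dist_sub_le z w x)
  simp only [geodesic, Set.mem_ofPred_eq] at hz hw
  rw [le_abs]
  rcases le_max_iff.1 (dist_fourPoint x y z w) with h | h
  · left; rw [dist_comm y w] at h; linarith
  · right; rw [dist_comm y z] at h; linarith

/-- The distance from `x` maps the geodesic isometrically into `[0, dist x y]`, and the inverse is
1-Lipschitz. -/
lemma lengthMeasure_geodesic_le (x y : Tree v) :
    lengthMeasure v (geodesic x y) ≤ ENNReal.ofReal (dist x y) := by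
  refine (Measure.restrict_le_self _).trans ?_
  set φ : Tree v → ℝ := fun z => dist x z
  have hinj : Set.InjOn φ (geodesic x y) := fun z hz w hw h => by
    rw [← dist_eq_zero, dist_eq_of_mem_geodesic hz hw]
    simpa [sub_eq_zero] using h
  have : Nonempty (Tree v) := ⟨x⟩
  set ψ := Function.invFunOn φ (geodesic x y)
  have hinv : Set.LeftInvOn ψ φ (geodesic x y) := hinj.leftInvOn_invFunOn
  have hψ : LipschitzOnWith 1 ψ (φ '' geodesic x y) := by
    rw [lipschitzOnWith_iff_dist_le_mul]
    rintro _ ⟨z, hz, rfl⟩ _ ⟨w, hw, rfl⟩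
    rw [hinv hz, hinv hw, dist_eq_of_mem_geodesic hz hw]
    simp [φ, Real.dist_eq]
  calc (μH[1] : Measure (Tree v)) (geodesic x y)
      = μH[1] (ψ '' (φ '' geodesic x y)) := by rw [hinv.image_image]
    _ ≤ ((1 : NNReal) : ℝ≥0∞) ^ (1 : ℝ) * μH[1] (φ '' geodesic x y) :=
        hψ.hausdorffMeasure_image_le zero_le_one
    _ = volume (φ '' geodesic x y) := by rw [hausdorffMeasure_real]; simp
    _ ≤ volume (Set.Icc 0 (dist x y)) := by
        refine measure_mono ?_
        rintro _ ⟨z, hz, rfl⟩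
        simp only [geodesic, Set.mem_ofPred_eq] at hz
        exact ⟨dist_nonneg, by have := dist_nonneg (x := z) (y := y); simp only [φ]; linarith⟩
    _ = ENNReal.ofReal (dist x y) := by simp

end LaaksoTree

namespace LaaksoTree

/-! ### The measure of cells -/

/-- The measure of the closed balls of radius `2 ^ n` of `U(b)`. -/
noncomputable def cellVolume (b : BranchingFunction) (n : ℤ) : ℝ :=
  if n + 1 ≤ 0 then (∏ k ∈ Finset.Icc (n + 1) 0, (b k : ℝ))⁻¹ else ∏ k ∈ Finset.Icc 1 n, (b k : ℝ)

lemma V_eq_cellVolume (b : BranchingFunction) (r : ℝ) : b.V r = cellVolume b (Int.log 2 r) := by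
  simp [BranchingFunction.V, cellVolume]

lemma cast_pos_of_branching (b : BranchingFunction) (k : ℤ) : (0 : ℝ) < b k := by
  have := b.two_le k
  exact_mod_cast (by omega : 0 < b k)

lemma cellVolume_pos (b : BranchingFunction) (n : ℤ) : 0 < cellVolume b n := by
  unfold cellVolume
  split_ifs
  · exact inv_pos.2 (Finset.prod_pos fun k _ => cast_pos_of_branching b k)
  · exact Finset.prod_pos fun k _ => cast_pos_of_branching b k

lemma cellVolume_succ (b : BranchingFunction) (n : ℤ) :
    cellVolume b (n + 1) = b (n + 1) * cellVolume b n := by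
  have hb := cast_pos_of_branching b (n + 1)
  unfold cellVolume
  rcases lt_trichotomy (n + 1) 0 with h | h | h
  · rw [if_pos (by omega), if_pos (by omega)]
    have : Finset.Icc (n + 1) 0 = insert (n + 1) (Finset.Icc (n + 1 + 1) 0) := by
      ext k; simp only [Finset.mem_Icc, Finset.mem_insert]; omega
    rw [this, Finset.prod_insert (by simp), mul_inv, mul_inv_cancel_left₀ hb.ne']
  · rw [if_neg (by omega), if_pos (by omega), h, Finset.Icc_self, Finset.prod_singleton,
      Finset.Icc_eq_empty (by norm_num), Finset.prod_empty, ← h, mul_inv_cancel₀ hb.ne']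
  · rw [if_neg (by omega), if_neg (by omega)]
    have : Finset.Icc 1 (n + 1) = insert (n + 1) (Finset.Icc 1 n) := by
      ext k; simp only [Finset.mem_Icc, Finset.mem_insert]; omega
    rw [this, Finset.prod_insert (by simp)]

/-- The addresses that agree with `w` at all levels above `n`. -/
def cell (b : BranchingFunction) (n : ℤ) (w : ℤ → ℕ) : Set b.U := {t | ∀ k > n, t.1 k = w k}

lemma measurable_coord (b : BranchingFunction) (k : ℤ) : Measurable fun t : b.U => t.1 k :=
  (measurable_pi_apply k).comp measurable_subtype_coe

lemma measurableSet_cell (b : BranchingFunction) (n : ℤ) (w : ℤ → ℕ) :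
    MeasurableSet (cell b n w) := by
  have : cell b n w = ⋂ k : ℤ, ⋂ _ : k > n, {t : b.U | t.1 k = w k} := by
    ext t; simp [cell]
  rw [this]
  exact MeasurableSet.iInter fun k => MeasurableSet.iInter fun _ =>
    measurable_coord b k (measurableSet_singleton (w k))

lemma measurable_join (b : BranchingFunction) (τ : b.Tail) : Measurable (b.join τ) := by
  refine Measurable.subtype_mk (measurable_pi_lambda _ fun k => ?_)
  by_cases h : k ≤ 0
  · simp only [h, dite_true]
    exact (measurable_of_finite (fun i : Fin (b k) => (i : ℕ))).comp (measurable_pi_apply _)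
  · simp only [h, dite_false]
    exact measurable_const

lemma uniformOn_fin_le (n : ℕ) [NeZero n] (a : ℕ) :
    ProbabilityTheory.uniformOn (Set.univ : Set (Fin n)) {i | (i : ℕ) = a} ≤ (n : ℝ≥0∞)⁻¹ := by
  rw [ProbabilityTheory.uniformOn_univ, Fintype.card_fin, ENNReal.div_eq_inv_mul]
  refine mul_le_of_le_one_right' ?_
  have hs : {i : Fin n | (i : ℕ) = a}.Subsingleton := fun i hi j hj =>
    Fin.ext (hi.trans hj.symm)
  rcases hs.eq_empty_or_singleton with h | ⟨i, h⟩ <;> simp [h]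

lemma infinitePi_cylinder_le (b : BranchingFunction) {n : ℤ} (hn : n ≤ 0) (w : ℤ → ℕ) :
    (Measure.infinitePi fun k : {k : ℤ // k ≤ 0} =>
      ProbabilityTheory.uniformOn (Set.univ : Set (Fin (b k))))
        {x | ∀ k : {k : ℤ // k ≤ 0}, n < k → (x k : ℕ) = w k} ≤ ENNReal.ofReal (cellVolume b n) := by
  have hset : {x : (k : {k : ℤ // k ≤ 0}) → Fin (b k) |
      ∀ k : {k : ℤ // k ≤ 0}, n < k → (x k : ℕ) = w k} =
      Set.pi ((Finset.Icc (n + 1) 0).subtype (· ≤ 0) : Finset {k : ℤ // k ≤ 0})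
        fun k : {k : ℤ // k ≤ 0} => {i : Fin (b k) | (i : ℕ) = w k} := by
    ext x
    simp only [Set.mem_ofPred_eq, Set.mem_pi, Finset.mem_coe, Finset.mem_subtype, Finset.mem_Icc]
    exact ⟨fun h k hk => h k (by omega), fun h k hk => h k ⟨by omega, k.2⟩⟩
  -- At `n = 0` the definition takes its second branch, but both products are empty.
  have hvol : cellVolume b n = ∏ k ∈ Finset.Icc (n + 1) 0, (b k : ℝ)⁻¹ := by
    rw [cellVolume, Finset.prod_inv_distrib]
    split_ifs with h
    · rfl
    · rw [Finset.Icc_eq_empty (by omega), Finset.Icc_eq_empty (by omega)]; simp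
  rw [hset, Measure.infinitePi_pi _ fun _ _ => (Set.toFinite _).measurableSet, hvol,
    ENNReal.ofReal_prod_of_nonneg fun k _ => (inv_pos.2 (cast_pos_of_branching b k)).le]
  calc ∏ k ∈ (Finset.Icc (n + 1) 0).subtype (· ≤ 0),
        ProbabilityTheory.uniformOn (Set.univ : Set (Fin (b k))) {i | (i : ℕ) = w k}
      ≤ ∏ k ∈ (Finset.Icc (n + 1) 0).subtype (· ≤ 0), ((b k : ℕ) : ℝ≥0∞)⁻¹ :=
        Finset.prod_le_prod' fun k _ => uniformOn_fin_le _ _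
    _ = ∏ k ∈ Finset.Icc (n + 1) 0, ((b k : ℕ) : ℝ≥0∞)⁻¹ :=
        Finset.prod_subtype_of_mem (fun k : ℤ => ((b k : ℕ) : ℝ≥0∞)⁻¹) fun k hk => (Finset.mem_Icc.1 hk).2
    _ = ∏ k ∈ Finset.Icc (n + 1) 0, ENNReal.ofReal (b k : ℝ)⁻¹ := by
        refine Finset.prod_congr rfl fun k _ => ?_
        rw [ENNReal.ofReal_inv_of_pos (cast_pos_of_branching b k), ENNReal.ofReal_natCast]

/-- For `n ≤ 0` a cell fixes all coordinates above `0`, so at most one summand of `measureU`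
contributes. Larger cells are handled by splitting them into subcells. -/
lemma measureU_cell_le_of_nonpos (b : BranchingFunction) {n : ℤ} (hn : n ≤ 0) (w : ℤ → ℕ) :
    b.measureU (cell b n w) ≤ ENNReal.ofReal (cellVolume b n) := by
  have hτ : ∀ τ τ' : b.Tail, (∀ k > 0, τ.1.1 k = w k) → (∀ k > 0, τ'.1.1 k = w k) → τ = τ' := by
    intro τ τ' h h'
    refine Subtype.ext (Subtype.ext (funext fun k => ?_))
    rcases le_or_gt k 0 with hk | hk
    · rw [τ.2 k hk, τ'.2 k hk]
    · rw [h k hk, h' k hk]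
  have hzero : ∀ τ : b.Tail, (¬ ∀ k > 0, τ.1.1 k = w k) → b.join τ ⁻¹' cell b n w = ∅ := by
    intro τ h
    refine Set.eq_empty_of_forall_notMem fun x hx => h fun k hk => ?_
    have := hx k (by omega)
    simpa [BranchingFunction.join, not_le.2 hk] using this
  rw [BranchingFunction.measureU, Measure.sum_apply _ (measurableSet_cell b n w)]
  simp only [Measure.map_apply (measurable_join b _) (measurableSet_cell b n w)]
  by_cases hex : ∃ τ : b.Tail, ∀ k > 0, τ.1.1 k = w k
  · obtain ⟨τ, h⟩ := hex
    rw [tsum_eq_single τ fun τ' hne => by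
      rw [hzero τ' fun h' => hne (hτ _ _ h' h), measure_empty]]
    refine (measure_mono fun x hx => ?_).trans (infinitePi_cylinder_le b hn w)
    intro k hk
    have := hx k hk
    simpa [BranchingFunction.join, k.2] using this
  · rw [ENNReal.tsum_eq_zero.2 fun τ => by rw [hzero τ fun h => hex ⟨τ, h⟩, measure_empty]]
    exact zero_le

lemma measureU_cell_le (b : BranchingFunction) (n : ℤ) (w : ℤ → ℕ) :
    b.measureU (cell b n w) ≤ ENNReal.ofReal (cellVolume b n) := by
  rcases le_total n 0 with hn | hn
  · exact measureU_cell_le_of_nonpos b hn w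
  induction n, hn using Int.leInduction generalizing w with
  | base => exact measureU_cell_le_of_nonpos b le_rfl w
  | succ n _ ih =>
    have hsub : cell b (n + 1) w ⊆
        ⋃ i ∈ Finset.range (b (n + 1)), cell b n (Function.update w (n + 1) i) := by
      intro t ht
      simp only [Set.mem_iUnion]
      refine ⟨t.1 (n + 1), Finset.mem_range.2 (t.2.1 _), fun k hk => ?_⟩
      by_cases h : k = n + 1
      · subst h; simp
      · rw [Function.update_of_ne h]; exact ht k (by omega)
    calc b.measureU (cell b (n + 1) w)
        ≤ ∑ i ∈ Finset.range (b (n + 1)), b.measureU (cell b n (Function.update w (n + 1) i)) :=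
          (measure_mono hsub).trans (measure_biUnion_finset_le _ _)
      _ ≤ ∑ _i ∈ Finset.range (b (n + 1)), ENNReal.ofReal (cellVolume b n) :=
          Finset.sum_le_sum fun i _ => ih _
      _ = ENNReal.ofReal (cellVolume b (n + 1)) := by
          rw [Finset.sum_const, Finset.card_range, nsmul_eq_mul, cellVolume_succ,
            ENNReal.ofReal_mul (by positivity), ENNReal.ofReal_natCast]

end LaaksoTree

namespace LaaksoTree

/-! ### The measure of balls -/

variable {b : BranchingFunction} (v : GluingVertices b)

/-- A point that lies in another `(k-1)`-cell than the gluing vertex `w` has distance at least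
`2 ^ (k-1)` from it. -/
lemma zpow_le_finDist_of_ne (N : ℕ) : ∀ (n k : ℤ) (s w : ℤ → ℕ), (∀ l < n, w l ≠ v.vert l l) →
    k ≤ n → n - N ≤ k → s k ≠ w k → (2 : ℝ) ^ (k - 1) ≤ finDist v.vert N n s w := by
  induction N with
  | zero =>
    intro n k s w hw hk hk' hne
    obtain rfl : k = n := by push_cast at hk'; omega
    simp only [finDist, if_neg hne]
    exact zpow_le_zpow_right₀ one_le_two (by omega)
  | succ N ih =>
    intro n k s w hw hk hk' hne
    simp only [finDist]
    split_ifs with h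
    · have hkn : k ≠ n := fun e => hne (e ▸ h)
      exact ih (n - 1) k s w (fun l hl => hw l (by omega)) (by omega) (by push_cast at hk'; omega) hne
    · rw [finDist_comm _ _ _ (v.vert (n - 1)) w,
        finDist_vert v N (n - 1) w fun l hl => hw l (by omega)]
      have : (2 : ℝ) ^ (k - 1) ≤ 2 ^ (n - 1) := zpow_le_zpow_right₀ one_le_two (by omega)
      linarith [finDist_nonneg v.vert N (n - 1) s (v.vert (n - 1))]

/-- Points in distinct `n`-cells at distance less than `2 ^ n` are separated by one gluing vertex
that both are close to. -/
lemma exists_level_of_limDist_lt {n : ℤ} {s t : b.U} (h : limDist v s t < 2 ^ n) :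
    ∃ j > n, (∀ k, n < k → k < j → s.1 k = v.vert (j - 1) k) ∧
      ∀ k > n, k ≠ j → t.1 k = s.1 k := by
  by_cases heq : ∀ k > n, s.1 k = t.1 k
  -- In a common `n`-cell, `j = n + 1` makes the condition on intermediate levels vacuous.
  · exact ⟨n + 1, by omega, fun k _ _ => by omega, fun k hk _ => (heq k hk).symm⟩
  push Not at heq
  obtain ⟨k₀, hk₀, hne₀⟩ := heq
  obtain ⟨a, ha⟩ := exists_forall_gt_eq s t
  -- At the greatest level `j` of disagreement the distance splits at `v_{j-1}`; leaving its address
  -- at a level `k` with `n < k < j` would already cost `2^(k-1) ≥ 2^n`.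
  obtain ⟨j, hj, hmax⟩ := Int.exists_greatest_of_bdd (P := fun k => s.1 k ≠ t.1 k)
    ⟨a, fun k hk => not_lt.1 fun hlt => hk (ha k hlt)⟩ ⟨k₀, hne₀⟩
  have hnj : n < j := hk₀.trans_le (hmax _ hne₀)
  have hagree : ∀ k > j, s.1 k = t.1 k := fun k hk => by
    by_contra hne
    exact absurd (hmax k hne) (by omega)
  have hfar : ∀ k, n < k → k < j → s.1 k = v.vert (j - 1) k ∧ t.1 k = v.vert (j - 1) k := by
    intro k hnk hkj
    by_contra hcon
    refine absurd h (not_lt.2 (ge_of_tendsto (tendsto_finDist_limDist v hagree) ?_))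
    filter_upwards [eventually_ge_atTop ((j - k).toNat + 1)] with M hM
    obtain ⟨N, rfl⟩ : ∃ N, M = N + 1 := ⟨M - 1, by omega⟩
    have hn : (2 : ℝ) ^ n ≤ 2 ^ (k - 1) := zpow_le_zpow_right₀ one_le_two (by omega)
    have hl : ∀ u : ℤ → ℕ, u k ≠ v.vert (j - 1) k →
        (2 : ℝ) ^ (k - 1) ≤ finDist v.vert N (j - 1) u (v.vert (j - 1)) := fun u hu =>
      zpow_le_finDist_of_ne v N _ k u _ (fun l hl => v.ne _ _ hl) (by omega) (by omega) hu
    have h0 := finDist_nonneg v.vert N (j - 1)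
    rw [finDist, if_neg hj, finDist_comm _ _ _ (v.vert (j - 1)) t.1]
    by_cases hs : s.1 k = v.vert (j - 1) k
    · linarith [hl t.1 fun ht => hcon ⟨hs, ht⟩, h0 s.1 (v.vert (j - 1))]
    · linarith [hl s.1 hs, h0 t.1 (v.vert (j - 1))]
  refine ⟨j, hnj, fun k h1 h2 => (hfar k h1 h2).1, fun k hk hkj => ?_⟩
  rcases lt_or_gt_of_ne hkj with hlt | hgt
  · rw [(hfar k hk hlt).1, (hfar k hk hlt).2]
  · exact (hagree k hgt).symm

/-- A set of diameter less than `2 ^ n` meets boundedly many `n`-cells. -/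
lemma exists_cover_of_limDist_lt (n : ℤ) (s : b.U) : ∃ j₀ : ℤ, {t | limDist v s t < 2 ^ n} ⊆
    ⋃ j ∈ ({n + 1, j₀} : Finset ℤ), ⋃ i ∈ Finset.range (b j),
      cell b n (Function.update s.1 j i) := by
  -- Two such levels `j < j₀` above `n + 1` would force `v_{j-1}` and `v_{j₀-1}` to agree with `s`,
  -- hence with each other, at level `j - 1`, which `v.ne` excludes.
  obtain ⟨j₀, hj₀⟩ : ∃ j₀ : ℤ, ∀ j > n, (∀ k, n < k → k < j → s.1 k = v.vert (j - 1) k) →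
      j = n + 1 ∨ j = j₀ := by
    by_cases hex : ∃ j > n + 1, ∀ k, n < k → k < j → s.1 k = v.vert (j - 1) k
    · obtain ⟨j₀, hj₀, h₀⟩ := hex
      refine ⟨j₀, fun j hj h => ?_⟩
      by_contra hcon
      rcases lt_trichotomy j j₀ with hlt | heq | hgt
      · exact v.ne (j₀ - 1) (j - 1) (by omega)
          ((h₀ (j - 1) (by omega) (by omega)).symm.trans (h (j - 1) (by omega) (by omega)))
      · omega
      · exact v.ne (j - 1) (j₀ - 1) (by omega)
          ((h (j₀ - 1) (by omega) (by omega)).symm.trans (h₀ (j₀ - 1) (by omega) (by omega)))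
    · refine ⟨n + 1, fun j hj h => ?_⟩
      by_contra hcon
      exact hex ⟨j, by omega, h⟩
  refine ⟨j₀, fun t ht => ?_⟩
  obtain ⟨j, hj, h1, h2⟩ := exists_level_of_limDist_lt v ht
  simp only [Set.mem_iUnion]
  refine ⟨j, by simpa using hj₀ j hj h1, t.1 j, Finset.mem_range.2 (t.2.1 j), fun k hk => ?_⟩
  by_cases h : k = j
  · subst h; simp
  · rw [Function.update_of_ne h]; exact h2 k hk h

lemma measureU_limDist_lt_le {M : ℕ} (hM : ∀ k, b k ≤ M) (n : ℤ) (s : b.U) :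
    b.measureU {t | limDist v s t < 2 ^ n} ≤ 2 * M * ENNReal.ofReal (cellVolume b n) := by
  obtain ⟨j₀, hsub⟩ := exists_cover_of_limDist_lt v n s
  calc b.measureU {t | limDist v s t < 2 ^ n}
      ≤ ∑ j ∈ ({n + 1, j₀} : Finset ℤ), ∑ i ∈ Finset.range (b j),
          b.measureU (cell b n (Function.update s.1 j i)) :=
        (measure_mono hsub).trans ((measure_biUnion_finset_le _ _).trans
          (Finset.sum_le_sum fun j _ => measure_biUnion_finset_le _ _))
    _ ≤ ∑ _j ∈ ({n + 1, j₀} : Finset ℤ), M * ENNReal.ofReal (cellVolume b n) := by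
        refine Finset.sum_le_sum fun j _ => ?_
        refine (Finset.sum_le_sum fun i _ => measureU_cell_le b n _).trans ?_
        rw [Finset.sum_const, Finset.card_range, nsmul_eq_mul]
        gcongr
        exact hM j
    _ ≤ 2 * M * ENNReal.ofReal (cellVolume b n) := by
        rw [Finset.sum_const, nsmul_eq_mul, mul_assoc]
        gcongr
        exact_mod_cast Finset.card_le_two

variable {v}

lemma treeMeasure_ball_le {M : ℕ} (hM : ∀ k, b k ≤ M) (x : Tree v) (r : ℝ) :
    treeMeasure v (Metric.ball x r) ≤ ENNReal.ofReal (2 * M ^ 3 * b.V r) := by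
  set l : ℤ := Int.log 2 r
  have hrl : r < 2 ^ (l + 1) := by exact_mod_cast Int.lt_zpow_succ_log_self (b := 2) one_lt_two r
  have hpre : b.measureU (proj v ⁻¹' Metric.ball x r) ≤ ENNReal.ofReal (2 * M ^ 3 * b.V r) := by
    rcases (proj v ⁻¹' Metric.ball x r).eq_empty_or_nonempty with he | ⟨s, hs⟩
    · simp [he]
    -- The center `x` need not be a projected address; recentering at `s` doubles the radius, and
    -- `2r < 2^(l+2)`.
    have hsub : proj v ⁻¹' Metric.ball x r ⊆ {t | limDist v s t < 2 ^ (l + 1 + 1)} := by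
      intro t ht
      simp only [Set.mem_preimage, Metric.mem_ball] at hs ht
      have := dist_triangle_right (proj v s) (proj v t) x
      rw [dist_proj] at this
      simp only [Set.mem_ofPred_eq]
      rw [zpow_add_one₀ two_ne_zero]
      linarith
    have hvol : cellVolume b (l + 1 + 1) ≤ M ^ 2 * b.V r := by
      rw [V_eq_cellVolume, cellVolume_succ, cellVolume_succ, sq, mul_assoc]
      have := (cellVolume_pos b l).le
      have h1 : (b (l + 1) : ℝ) ≤ M := by exact_mod_cast hM _
      have h2 : (b (l + 1 + 1) : ℝ) ≤ M := by exact_mod_cast hM _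
      gcongr
    calc b.measureU (proj v ⁻¹' Metric.ball x r)
        ≤ 2 * M * ENNReal.ofReal (cellVolume b (l + 1 + 1)) :=
          (measure_mono hsub).trans (measureU_limDist_lt_le v hM _ s)
      _ ≤ 2 * M * ENNReal.ofReal (M ^ 2 * b.V r) := by gcongr
      _ = ENNReal.ofReal (2 * M ^ 3 * b.V r) := by
          rw [show (2 : ℝ) * M ^ 3 * b.V r = (2 * M) * (M ^ 2 * b.V r) by ring,
            ENNReal.ofReal_mul (p := 2 * (M : ℝ)) (by positivity),
            ENNReal.ofReal_mul (p := 2) two_pos.le, ENNReal.ofReal_natCast, ENNReal.ofReal_ofNat]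
  -- Without a.e. measurability `Measure.map` is the zero measure and the bound is trivial.
  by_cases hm : AEMeasurable (proj v) b.measureU
  · rwa [treeMeasure, Measure.map_apply_of_aemeasurable hm measurableSet_ball]
  · simp [treeMeasure, Measure.map_of_not_aemeasurable hm]

/-! ### The oscillation of functions with a gradient -/

lemma enorm_rpow_eq (a : ℝ) {p : ℝ} (hp : 0 ≤ p) : ENNReal.ofReal (|a| ^ p) = ‖a‖ₑ ^ p := by
  rw [Real.enorm_eq_ofReal_abs, ENNReal.ofReal_rpow_of_nonneg (abs_nonneg a) hp]

/-- Hölder's inequality against the constant `1`, whose norm is controlled by the length of the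
geodesic. -/
lemma lintegral_geodesic_le {p : ℝ} (hp : 1 < p) {g : Tree v → ℝ}
    (hg : AEStronglyMeasurable g (lengthMeasure v)) {x y : Tree v} {B : Set (Tree v)} {D : ℝ}
    (hB : geodesic x y ⊆ B) (hD : dist x y ≤ D) :
    ∫⁻ z in geodesic x y, ‖g z‖ₑ ∂lengthMeasure v ≤
      (∫⁻ z in B, ‖g z‖ₑ ^ p ∂lengthMeasure v) ^ (1 / p) * ENNReal.ofReal D ^ (1 - 1 / p) := by
  have hpq := Real.HolderConjugate.conjExponent hp
  have hq : 1 / p.conjExponent = 1 - 1 / p := by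
    have := hpq.inv_add_inv_eq_one
    rw [one_div, one_div]
    linarith
  have hpos : 0 ≤ 1 - 1 / p := by rw [← hq]; exact one_div_nonneg.2 hpq.symm.nonneg
  have h := ENNReal.lintegral_mul_le_Lp_mul_Lq ((lengthMeasure v).restrict (geodesic x y)) hpq
    hg.restrict.enorm (aemeasurable_const (b := (1 : ℝ≥0∞)))
  simp only [Pi.mul_apply, mul_one, ENNReal.one_rpow, lintegral_const, one_mul,
    Measure.restrict_apply_univ, hq] at h
  refine h.trans ?_
  gcongr
  exact (lengthMeasure_geodesic_le x y).trans (ENNReal.ofReal_le_ofReal hD)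

/-- The branch point lies in the ball by convexity. The two oriented pieces are estimated
separately, whence the factor `2`. -/
lemma IsGradient.enorm_sub_le {p : ℝ} (hp : 1 < p) {ρ : Tree v} {f g : Tree v → ℝ}
    (hg : IsGradient ρ f g) {a : Tree v} {r : ℝ} {x y : Tree v} (hx : x ∈ Metric.ball a r)
    (hy : y ∈ Metric.ball a r) :
    ‖f y - f x‖ₑ ≤ 2 * ((∫⁻ z in Metric.ball a r, ‖g z‖ₑ ^ p ∂lengthMeasure v) ^ (1 / p) *
      ENNReal.ofReal (2 * r) ^ (1 - 1 / p)) := by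
  obtain ⟨c, hc, hsub⟩ := hg.sub_eq x y
  have hcg := mem_geodesic_of_inter_eq hc
  have hcB := geodesic_subset_ball hx hy hcg
  have hdist : ∀ z ∈ Metric.ball a r, dist c z ≤ 2 * r := fun z hz => by
    have := dist_triangle_right c z a
    rw [Metric.mem_ball] at hcB hz
    linarith
  rw [hsub, two_mul]
  refine (_root_.enorm_sub_le).trans (add_le_add ?_ ?_)
  · exact (enorm_integral_le_lintegral_enorm _).trans
      (lintegral_geodesic_le hp hg.measurable (geodesic_subset_ball hcB hy) (hdist y hy))
  · exact (enorm_integral_le_lintegral_enorm _).trans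
      (lintegral_geodesic_le hp hg.measurable (geodesic_subset_ball hcB hx) (hdist x hx))

end LaaksoTree

/-! ### The mean value and the Poincaré inequality -/

/-- All values of `f` on `B` lie in a closed ball about `f y`, which is convex and closed and so
contains their mean. -/
lemma enorm_sub_setAverage_le {α : Type*} [MeasurableSpace α] {μ : Measure α} {f : α → ℝ}
    {B : Set α} (hB : MeasurableSet B) (h0 : μ B ≠ 0) (hfin : μ B ≠ ∞) (hf : IntegrableOn f B μ)
    {K : ℝ≥0∞} (hK : K ≠ ∞) {y : α} (h : ∀ x ∈ B, ‖f y - f x‖ₑ ≤ K) :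
    ‖f y - ⨍ x in B, f x ∂μ‖ₑ ≤ K := by
  have : IsFiniteMeasure (μ.restrict B) := isFiniteMeasure_restrict.2 hfin
  have : NeZero (μ.restrict B) := ⟨by rwa [Ne, Measure.restrict_eq_zero]⟩
  have hmem : ∀ a : ℝ, a ∈ Metric.closedBall (f y) K.toReal ↔ ‖f y - a‖ₑ ≤ K := fun a => by
    rw [Metric.mem_closedBall', dist_eq_norm, ← toReal_enorm,
      ENNReal.toReal_le_toReal enorm_ne_top hK]
  exact (hmem _).1 ((convex_closedBall _ _).average_mem Metric.isClosed_closedBall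
    (ae_restrict_of_forall_mem hB fun x hx => (hmem _).2 (h x hx)) hf)

open LaaksoTree in
theorem proposition3p5 (b : BranchingFunction) (v : GluingVertices b) (p : ℝ) (hp : 1 < p) :
    ∃ C : ℝ, 0 < C ∧ ∀ (x : Tree v) (r : ℝ), 0 < r →
      ∀ (ρ : Tree v) (f g : Tree v → ℝ), MemDomain p ρ f → IsGradient ρ f g →
        ∫⁻ y in Metric.ball x r,
            ENNReal.ofReal (|f y - ⨍ z in Metric.ball x r, f z ∂treeMeasure v| ^ p) ∂treeMeasure v
          ≤ ENNReal.ofReal (C * r ^ (p - 1) * b.V r) *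
            ∫⁻ y in Metric.ball x r, ENNReal.ofReal (|g y| ^ p) ∂lengthMeasure v := by
  obtain ⟨M, hM⟩ : ∃ M : ℕ, ∀ k, b k ≤ M := by
    obtain ⟨M, hM⟩ := b.bddAbove
    exact ⟨M, fun k => hM ⟨k, rfl⟩⟩
  have hMpos : (0 : ℝ) < M := by
    have h0 := hM 0
    have := b.two_le 0
    exact_mod_cast (by omega : 0 < M)
  have hp0 : 0 < p := by linarith
  -- `2 ^ p` comes from the two geodesic pieces, `2 ^ (p - 1)` from the length bound `2r`, and `2 *
  -- M ^ 3` from the measure of the ball.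
  refine ⟨2 ^ p * 2 ^ (p - 1) * (2 * M ^ 3), by positivity, fun x r hr ρ f g hf hg => ?_⟩
  have hV : 0 < b.V r := by rw [V_eq_cellVolume]; exact cellVolume_pos b _
  have hball := treeMeasure_ball_le hM x r
  simp only [enorm_rpow_eq _ hp0.le]
  set E := ∫⁻ z in Metric.ball x r, ‖g z‖ₑ ^ p ∂lengthMeasure v
  -- The right side is then infinite, since the constant in front is positive.
  by_cases hE : E = ∞
  · rw [hE, ENNReal.mul_top (by simpa using by positivity)]
    exact le_top
  by_cases h0 : treeMeasure v (Metric.ball x r) = 0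
  · rw [setLIntegral_measure_zero _ _ h0]
    exact zero_le
  have hfin : treeMeasure v (Metric.ball x r) ≠ ∞ := ne_top_of_le_ne_top ENNReal.ofReal_ne_top hball
  have : IsFiniteMeasure ((treeMeasure v).restrict (Metric.ball x r)) :=
    isFiniteMeasure_restrict.2 hfin
  have hint : IntegrableOn f (Metric.ball x r) (treeMeasure v) :=
    (hf.memLp.restrict _).integrable (by simpa using hp.le)
  have h1p : 0 ≤ 1 - 1 / p := by
    rw [sub_nonneg, div_le_one hp0]
    exact hp.le
  set K := 2 * (E ^ (1 / p) * ENNReal.ofReal (2 * r) ^ (1 - 1 / p)) with hKdef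
  have hK : K ≠ ∞ := ENNReal.mul_ne_top (by simp) (ENNReal.mul_ne_top
    (ENNReal.rpow_ne_top_of_nonneg (by positivity) hE)
    (ENNReal.rpow_ne_top_of_nonneg h1p ENNReal.ofReal_ne_top))
  have hKp : K ^ p = ENNReal.ofReal (2 ^ p * 2 ^ (p - 1) * r ^ (p - 1)) * E := by
    have e : (1 - 1 / p) * p = p - 1 := by field_simp
    rw [hKdef, ENNReal.mul_rpow_of_nonneg _ _ hp0.le, ENNReal.mul_rpow_of_nonneg _ _ hp0.le,
      ← ENNReal.rpow_mul, ← ENNReal.rpow_mul, one_div_mul_cancel hp0.ne', ENNReal.rpow_one, e,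
      mul_assoc (2 ^ p : ℝ), ← Real.mul_rpow two_pos.le hr.le, ENNReal.ofReal_mul (p := (2 : ℝ) ^ p) (by positivity),
      ← ENNReal.ofReal_rpow_of_pos two_pos, ← ENNReal.ofReal_rpow_of_pos (by positivity),
      ENNReal.ofReal_ofNat]
    ring
  calc ∫⁻ y in Metric.ball x r, ‖f y - ⨍ z in Metric.ball x r, f z ∂treeMeasure v‖ₑ ^ p ∂treeMeasure v
      ≤ ∫⁻ _y in Metric.ball x r, K ^ p ∂treeMeasure v :=
        setLIntegral_mono' measurableSet_ball fun y hy => ENNReal.rpow_le_rpow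
          (enorm_sub_setAverage_le measurableSet_ball h0 hfin hint hK
            fun z hz => hg.enorm_sub_le hp hz hy) hp0.le
    _ = K ^ p * treeMeasure v (Metric.ball x r) := setLIntegral_const _ _
    _ ≤ K ^ p * ENNReal.ofReal (2 * M ^ 3 * b.V r) := by gcongr
    _ = ENNReal.ofReal (2 ^ p * 2 ^ (p - 1) * (2 * M ^ 3) * r ^ (p - 1) * b.V r) * E := by
        rw [hKp, mul_right_comm, ← ENNReal.ofReal_mul (by positivity)]
        congr 2
        ring
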